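/- Let $(V,\omega)$ be a $4$-dimensional real symplectic vector space, and let the Einstein universe $\mathrm{Ein}^3$ be the space of Lagrangian planes of $V$, with its usual topology. A nonzero vector $p\in V$ (up to scale) represents the photon $[p]=\{L\in \mathrm{Ein}^3 : p\in L\}$. Let $u_+,u_-,v_+,v_-\in V$ satisfy $\omega(u_+,v_-)=\omega(u_-,v_+)=1$, all other products between these four vectors being zero, and put $P_0=\mathbb{R}v_++\mathbb{R}v_-$, $P_\infty=\mathbb{R}u_++\mathbb{R}u_-$, $S_1=\mathbb{R}u_++\mathbb{R}v_-$, $S_2=\mathbb{R}u_-+\mathbb{R}v_+$. The *crooked surface* $C$ determined by these vectors is $C=\mathcal{W}_+\cup\mathcal{W}_-\cup\mathcal{S}$, where - the *wing* $\mathcal{W}_+$ is the union of the photons $[tu_++sv_+]$ with $ts\ge 0$, $(t,s)\neq(0,0)$, and the *wing* $\mathcal{W}_-$ is the union of the photons $[tu_-+sv_-]$ with $ts\le 0$, $(t,s)\ne(0,0)$; - the *(open) stem* $\mathcal{S}$ is the set of Lagrangian planes $L=\mathbb{R}w+\mathbb{R}w'$ with $w\in S_1$, $w'\in S_2$ which are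 timelike with respect to $P_0,P_\infty$. That is, $L$ is transverse to $P_0$ and to $P_\infty$, and $|m(P_0,L,P_\infty)|=2$, where the Maslov index $m(P_0,L,P_\infty)$ is the number of positive minus the number of negative eigenvalues of the restriction to $L$ of the quadratic form $x\mapsto\omega(\pi_{P_0}x,\pi_{P_\infty}x)$ given by the splitting $V=P_0\oplus P_\infty$. The *closed stem* $\overline{\mathcal{S}}$ is the closure of $\mathcal{S}$ in $\mathrm{Ein}^3$, and $\partial\mathcal{S}=\overline{\mathcal{S}}\setminus\mathcal{S}$ is the *boundary* of the stem. **Theorem.** Let $C_1,C_2$ be two crooked surfaces in $\mathrm{Ein}^3$, with open stems $\mathcal{S}_1$ and $\mathcal{S}_2$ (indices now refer to the surfaces). 1. If the closed stems $\overline{\mathcal{S}_1}$ and $\overline{\mathcal{S}_2}$ intersect (in particular, if $\mathcal{S}_1\cap\mathcal{S}_2\ne\emptyset$), then the closed stem of $C_1$ intersects a wing of $C_2$, or the closed stem of $C_2$ intersects a wing of $C_1$. 2. If $\mathcal{S}_1\cap\mathcal{S}_2\neq\emptyset$ and the boundaries $\partial\mathcal{S}_1$ and $\partial\mathcal{S}_2$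 are disjoint, then the open stem of $C_1$ intersects a wing of $C_2$, or the open stem of $C_2$ intersects a wing of $C_1$. 3. Crooked surfaces cannot intersect only in their stems: if $C_1\cap C_2\neq\emptyset$, then $C_1\cap C_2\not\subseteq \mathcal{S}_1\cap\mathcal{S}_2$. -/

import Mathlib

open scoped LinearAlgebra.Projectivization

namespace EinsteinUniverse

section

variable {V : Type*} [NormedAddCommGroup V] [NormedSpace ℝ V]

/-- A `2`-dimensional subspace on which `ω` vanishes identically. -/
def IsLagrangian (ω : LinearMap.BilinForm ℝ V) (L : Submodule ℝ V) : Prop :=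
  Module.finrank ℝ L = 2 ∧ ∀ x ∈ L, ∀ y ∈ L, ω x y = 0

/-- The symplectic model of the Einstein universe: for `(V, ω)` a `4`-dimensional real symplectic
vector space, the points of `Ein³` are the Lagrangian planes of `V`. -/
def Ein (ω : LinearMap.BilinForm ℝ V) : Type _ :=
  {L : Submodule ℝ V // IsLagrangian ω L}

/-- The Lagrangian plane underlying a point of `Ein³`. -/
def Ein.plane {ω : LinearMap.BilinForm ℝ V} (p : Ein ω) : Submodule ℝ V := p.1

/-- Pairs of vectors spanning a Lagrangian plane (such pairs are bases of it). -/
def LagrangianFrame (ω : LinearMap.BilinForm ℝ V) : Type _ :=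
  {p : V × V // IsLagrangian ω (Submodule.span ℝ {p.1, p.2})}

instance (ω : LinearMap.BilinForm ℝ V) : TopologicalSpace (LagrangianFrame ω) :=
  inferInstanceAs
    (TopologicalSpace {p : V × V // IsLagrangian ω (Submodule.span ℝ {p.1, p.2})})

/-- The plane spanned by a Lagrangian frame. -/
def LagrangianFrame.toEin {ω : LinearMap.BilinForm ℝ V} (p : LagrangianFrame ω) : Ein ω :=
  ⟨Submodule.span ℝ {p.1.1, p.1.2}, p.2⟩

/-- The usual topology of the Lagrangian Grassmannian: the quotient topology from the space of
Lagrangian frames. (For finite-dimensional `V` it does not depend on the norm.) -/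
instance (ω : LinearMap.BilinForm ℝ V) : TopologicalSpace (Ein ω) :=
  TopologicalSpace.coinduced LagrangianFrame.toEin inferInstance

/-- The photon represented by a point of the projective space of `V`, as a set of points of
`Ein³`: the Lagrangian planes containing the given line. -/
def photon (ω : LinearMap.BilinForm ℝ V) (φ : ℙ ℝ V) : Set (Ein ω) :=
  {p | φ.submodule ≤ p.plane}

/-- For a splitting `V = L ⊕ L'`, the quadratic form `v ↦ ω (π_L v, π_{L'} v)`. -/
noncomputable def splittingForm (ω : LinearMap.BilinForm ℝ V) {L L' : Submodule ℝ V}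
    (h : IsCompl L L') : QuadraticForm ℝ V :=
  LinearMap.BilinMap.toQuadraticMap
    (ω.compl₁₂ (L.projection L' h) (L'.projection L h.symm))

/-- The Maslov index `m(L, P, L')`: the number of positive minus the number of negative
eigenvalues of the restriction to `P` of the quadratic form of the splitting `V = L ⊕ L'`. -/
noncomputable def maslovIndex (ω : LinearMap.BilinForm ℝ V) {L L' : Submodule ℝ V}
    (h : IsCompl L L') (P : Submodule ℝ V) : ℤ :=
  (sigPos ((splittingForm ω h).restrict P) : ℤ) -
    (sigNeg ((splittingForm ω h).restrict P) : ℤ)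

/-- `P` is timelike with respect to `L` and `L'`: the three planes are pairwise transverse and
`|m(L, P, L')| = 2`. -/
def IsTimelike (ω : LinearMap.BilinForm ℝ V) (L P L' : Submodule ℝ V) : Prop :=
  ∃ h : IsCompl L L', IsCompl L P ∧ IsCompl P L' ∧ |maslovIndex ω h P| = 2

/-- The configuration defining a crooked surface (a lightlike quadrilateral): four vectors with
`ω(u₊, v₋) = ω(u₋, v₊) = 1`, all other products between them being zero. -/
structure LightlikeQuadrilateral (ω : LinearMap.BilinForm ℝ V) where
  uPlus : V
  uMinus : V
  vPlus : V
  vMinus : V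
  uPlus_vMinus : ω uPlus vMinus = 1
  uMinus_vPlus : ω uMinus vPlus = 1
  uPlus_uMinus : ω uPlus uMinus = 0
  uPlus_vPlus : ω uPlus vPlus = 0
  uMinus_vMinus : ω uMinus vMinus = 0
  vPlus_vMinus : ω vPlus vMinus = 0

namespace LightlikeQuadrilateral

variable {ω : LinearMap.BilinForm ℝ V} (C : LightlikeQuadrilateral ω)

/-- `P₀ = ℝ v₊ + ℝ v₋`. -/
def planeZero : Submodule ℝ V := Submodule.span ℝ {C.vPlus, C.vMinus}

/-- `P_∞ = ℝ u₊ + ℝ u₋`. -/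
def planeInfty : Submodule ℝ V := Submodule.span ℝ {C.uPlus, C.uMinus}

/-- `S₁ = ℝ u₊ + ℝ v₋`. -/
def planeS₁ : Submodule ℝ V := Submodule.span ℝ {C.uPlus, C.vMinus}

/-- `S₂ = ℝ u₋ + ℝ v₊`. -/
def planeS₂ : Submodule ℝ V := Submodule.span ℝ {C.uMinus, C.vPlus}

/-- The photons `[t u₊ + s v₊]`, `t s ≥ 0`, covering the wing `𝒲₊`. -/
def wingPlusPhotons : Set (ℙ ℝ V) :=
  {φ | ∃ (t s : ℝ) (h : t • C.uPlus + s • C.vPlus ≠ 0),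
    0 ≤ t * s ∧ φ = Projectivization.mk ℝ (t • C.uPlus + s • C.vPlus) h}

/-- The photons `[t u₋ + s v₋]`, `t s ≤ 0`, covering the wing `𝒲₋`. -/
def wingMinusPhotons : Set (ℙ ℝ V) :=
  {φ | ∃ (t s : ℝ) (h : t • C.uMinus + s • C.vMinus ≠ 0),
    t * s ≤ 0 ∧ φ = Projectivization.mk ℝ (t • C.uMinus + s • C.vMinus) h}

/-- The wing `𝒲₊` as a set of points of `Ein³`. -/
def wingPlus : Set (Ein ω) := ⋃ φ ∈ C.wingPlusPhotons, photon ω φ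

/-- The wing `𝒲₋` as a set of points of `Ein³`. -/
def wingMinus : Set (Ein ω) := ⋃ φ ∈ C.wingMinusPhotons, photon ω φ

/-- The union of the two wings. -/
def wings : Set (Ein ω) := C.wingPlus ∪ C.wingMinus

/-- The (open) stem: the points `ℝ w + ℝ w'`, `w ∈ S₁`, `w' ∈ S₂`, of the Einstein torus of the
splitting `S₁ ⊕ S₂` that are timelike with respect to `P₀` and `P_∞`. -/
def stem : Set (Ein ω) :=
  {p | (∃ w ∈ C.planeS₁, ∃ w' ∈ C.planeS₂, p.plane = Submodule.span ℝ {w, w'}) ∧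
    IsTimelike ω C.planeZero p.plane C.planeInfty}

/-- The closed stem: the closure of the stem in `Ein³`. -/
def closedStem : Set (Ein ω) := closure C.stem

/-- The boundary of the stem: the points of the closed stem that are not in the open stem. -/
def stemBoundary : Set (Ein ω) := C.closedStem \ C.stem

/-- The crooked surface: the union of its two wings and its stem. -/
def crookedSurface : Set (Ein ω) := C.wingPlus ∪ C.wingMinus ∪ C.stem

end LightlikeQuadrilateral

end

end EinsteinUniverse

/-! The splitting `V = S₁ ⊕ S₂` is `ω`-orthogonal, so a line in `S₁` and a line in `S₂` always span
a Lagrangian plane; these planes form a torus `ℙ(S₁) × ℙ(S₂)`. On the torus, being timelike means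
that `quad` is definite, i.e. `quad w * quad w' > 0`. In terms of arbitrary frames, the stem is
`torusForm = 0`, `stemDet > 0` (`mem_stem_iff`), and its closure is `torusForm = 0`, `stemDet ≥ 0`
(`mem_closedStem_iff`). On the boundary `w` or `w'` is a multiple of one of the four defining
vectors, so the boundary lies in the wings (`stemBoundary_subset_wings`).

All three claims then reduce to one fact: if the open stems meet, some point lies in both closed
stems but misses at least one open stem (`exists_mem_closedStems_of_stems_meet`). The second torus
cuts the first in the zero set of a bilinear form on `S₁ × S₂`, a curve of bidegree `(1,1)` or
everything. From a common stem point one can move inside this set until the first `stemDet`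
vanishes. The minimum of the two `stemDet`s starts positive and ends nonpositive, so it vanishes on
the way, and there the path lies in both closed stems and on the boundary of one of them. -/

namespace EinsteinUniverse

variable {V : Type*} [NormedAddCommGroup V] [NormedSpace ℝ V]

/-! ### Signature of a quadratic form on a plane -/

section Signature

/-- A quadratic form on a plane has signature `±2` iff it is definite. -/
theorem abs_signature_eq_two_iff {M : Type*} [AddCommGroup M] [Module ℝ M]
    (hM : Module.finrank ℝ M = 2) (Q : QuadraticForm ℝ M) :
    |(sigPos Q : ℤ) - (sigNeg Q : ℤ)| = 2 ↔ Q.PosDef ∨ (-Q).PosDef := by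
  have : FiniteDimensional ℝ M := Module.finite_of_finrank_eq_succ hM
  have hsum := QuadraticForm.sigPos_add_sigNeg_add_radical (Q := Q)
  -- `sigPos` is the dimension of a maximal positive definite subspace, so the value `2` forces that
  -- subspace to be the whole plane. This is used for both `Q` and `-Q`.
  have key : ∀ Q' : QuadraticForm ℝ M, 2 ≤ sigPos Q' ↔ Q'.PosDef := by
    intro Q'
    constructor
    · intro h
      obtain ⟨W, hW, hpos⟩ := exists_finrank_eq_sigPos_and_posDef Q'
      have hle := W.finrank_le
      have htop : W = ⊤ := Submodule.eq_top_of_finrank_eq (by omega)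
      intro x hx
      exact hpos ⟨x, htop ▸ Submodule.mem_top⟩ (by simpa using hx)
    · intro h
      have := le_sigPos_of_posDef Q' (V := ⊤) (fun x hx => h x (by simpa using hx))
      rwa [finrank_top, hM] at this
  rw [← key, ← key, sigPos_neg, abs_eq (by norm_num)]
  omega

end Signature

/-! ### Coordinates adapted to a lightlike quadrilateral -/

namespace LightlikeQuadrilateral

variable {ω : LinearMap.BilinForm ℝ V} (C : LightlikeQuadrilateral ω)

/-- The coefficient of `u₊` in the basis `u₊, u₋, v₊, v₋`. -/
def coordUPlus : V →ₗ[ℝ] ℝ := ω.flip C.vMinus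

/-- The coefficient of `v₋` in the basis `u₊, u₋, v₊, v₋`. -/
def coordVMinus : V →ₗ[ℝ] ℝ := ω C.uPlus

/-- The coefficient of `u₋` in the basis `u₊, u₋, v₊, v₋`. -/
def coordUMinus : V →ₗ[ℝ] ℝ := ω.flip C.vPlus

/-- The coefficient of `v₊` in the basis `u₊, u₋, v₊, v₋`. -/
def coordVPlus : V →ₗ[ℝ] ℝ := ω C.uMinus

theorem coordUPlus_basis (hAlt : ω.IsAlt) :
    C.coordUPlus C.uPlus = 1 ∧ C.coordUPlus C.vMinus = 0 ∧
      C.coordUPlus C.uMinus = 0 ∧ C.coordUPlus C.vPlus = 0 :=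
  ⟨C.uPlus_vMinus, hAlt _, C.uMinus_vMinus, C.vPlus_vMinus⟩

theorem coordVMinus_basis (hAlt : ω.IsAlt) :
    C.coordVMinus C.uPlus = 0 ∧ C.coordVMinus C.vMinus = 1 ∧
      C.coordVMinus C.uMinus = 0 ∧ C.coordVMinus C.vPlus = 0 :=
  ⟨hAlt _, C.uPlus_vMinus, C.uPlus_uMinus, C.uPlus_vPlus⟩

theorem coordUMinus_basis (hAlt : ω.IsAlt) :
    C.coordUMinus C.uPlus = 0 ∧ C.coordUMinus C.vMinus = 0 ∧
      C.coordUMinus C.uMinus = 1 ∧ C.coordUMinus C.vPlus = 0 :=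
  ⟨C.uPlus_vPlus, hAlt.isRefl _ _ C.vPlus_vMinus, C.uMinus_vPlus, hAlt _⟩

theorem coordVPlus_basis (hAlt : ω.IsAlt) :
    C.coordVPlus C.uPlus = 0 ∧ C.coordVPlus C.vMinus = 0 ∧
      C.coordVPlus C.uMinus = 0 ∧ C.coordVPlus C.vPlus = 1 :=
  ⟨hAlt.isRefl _ _ C.uPlus_uMinus, C.uMinus_vMinus, hAlt _, C.uMinus_vPlus⟩

/-- The vector with given coordinates. -/
def ofCoords (a b c d : ℝ) : V :=
  a • C.uPlus + b • C.vMinus + (c • C.uMinus + d • C.vPlus)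

theorem coordUPlus_ofCoords (hAlt : ω.IsAlt) (a b c d : ℝ) :
    C.coordUPlus (C.ofCoords a b c d) = a := by
  obtain ⟨h₁, h₂, h₃, h₄⟩ := C.coordUPlus_basis hAlt
  simp [ofCoords, h₁, h₂, h₃, h₄]

theorem coordVMinus_ofCoords (hAlt : ω.IsAlt) (a b c d : ℝ) :
    C.coordVMinus (C.ofCoords a b c d) = b := by
  obtain ⟨h₁, h₂, h₃, h₄⟩ := C.coordVMinus_basis hAlt
  simp [ofCoords, h₁, h₂, h₃, h₄]

theorem coordUMinus_ofCoords (hAlt : ω.IsAlt) (a b c d : ℝ) :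
    C.coordUMinus (C.ofCoords a b c d) = c := by
  obtain ⟨h₁, h₂, h₃, h₄⟩ := C.coordUMinus_basis hAlt
  simp [ofCoords, h₁, h₂, h₃, h₄]

theorem coordVPlus_ofCoords (hAlt : ω.IsAlt) (a b c d : ℝ) :
    C.coordVPlus (C.ofCoords a b c d) = d := by
  obtain ⟨h₁, h₂, h₃, h₄⟩ := C.coordVPlus_basis hAlt
  simp [ofCoords, h₁, h₂, h₃, h₄]

/-- The four functionals are dual to the four vectors, which makes the vectors independent; in
dimension `4` they then span. -/
theorem ofCoords_coords (hdim : Module.finrank ℝ V = 4) (hAlt : ω.IsAlt) (x : V) :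
    C.ofCoords (C.coordUPlus x) (C.coordVMinus x) (C.coordUMinus x) (C.coordVPlus x) = x := by
  have hsum : ∀ g : Fin 4 → ℝ, ∑ i, g i • ![C.uPlus, C.vMinus, C.uMinus, C.vPlus] i =
      C.ofCoords (g 0) (g 1) (g 2) (g 3) := by
    intro g
    simp [Fin.sum_univ_four, ofCoords, add_assoc]
  have hli : LinearIndependent ℝ ![C.uPlus, C.vMinus, C.uMinus, C.vPlus] := by
    rw [Fintype.linearIndependent_iff]
    intro g hg
    rw [hsum] at hg
    have h0 := C.coordUPlus_ofCoords hAlt (g 0) (g 1) (g 2) (g 3)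
    have h1 := C.coordVMinus_ofCoords hAlt (g 0) (g 1) (g 2) (g 3)
    have h2 := C.coordUMinus_ofCoords hAlt (g 0) (g 1) (g 2) (g 3)
    have h3 := C.coordVPlus_ofCoords hAlt (g 0) (g 1) (g 2) (g 3)
    rw [hg, map_zero] at h0 h1 h2 h3
    intro i
    fin_cases i
    exacts [h0.symm, h1.symm, h2.symm, h3.symm]
  have : FiniteDimensional ℝ V := Module.finite_of_finrank_eq_succ hdim
  have hspan := hli.span_eq_top_of_card_eq_finrank' (by simp [hdim])
  obtain ⟨g, rfl⟩ := (Submodule.mem_span_range_iff_exists_fun ℝ).1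
    (hspan ▸ Submodule.mem_top : x ∈ Submodule.span ℝ (Set.range _))
  rw [hsum, C.coordUPlus_ofCoords hAlt, C.coordVMinus_ofCoords hAlt,
    C.coordUMinus_ofCoords hAlt, C.coordVPlus_ofCoords hAlt]

theorem eq_zero_of_coords (hdim : Module.finrank ℝ V = 4) (hAlt : ω.IsAlt) {x : V}
    (ha : C.coordUPlus x = 0) (hb : C.coordVMinus x = 0) (hc : C.coordUMinus x = 0)
    (hd : C.coordVPlus x = 0) : x = 0 := by
  rw [← C.ofCoords_coords hdim hAlt x, ha, hb, hc, hd]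
  simp [ofCoords]

/-- `S₁` and `S₂` are orthogonal hyperbolic planes, so `ω` is the sum of their area forms; the first
summand is `torusForm`. -/
theorem form_eq_coords (hdim : Module.finrank ℝ V = 4) (hAlt : ω.IsAlt) (x y : V) :
    ω x y = C.coordUPlus x * C.coordVMinus y - C.coordVMinus x * C.coordUPlus y +
      (C.coordUMinus x * C.coordVPlus y - C.coordVPlus x * C.coordUMinus y) := by
  have h₁ : ω C.vMinus y = -C.coordUPlus y := (LinearMap.IsAlt.neg hAlt _ _).symm
  have h₂ : ω C.vPlus y = -C.coordUMinus y := (LinearMap.IsAlt.neg hAlt _ _).symm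
  have h₃ : ω C.uPlus y = C.coordVMinus y := rfl
  have h₄ : ω C.uMinus y = C.coordVPlus y := rfl
  conv_lhs => rw [← C.ofCoords_coords hdim hAlt x]
  simp only [ofCoords, map_add, map_smul, LinearMap.add_apply, LinearMap.smul_apply, smul_eq_mul,
    h₁, h₂, h₃, h₄]
  ring

theorem mem_planeS₁_iff (hdim : Module.finrank ℝ V = 4) (hAlt : ω.IsAlt) {x : V} :
    x ∈ C.planeS₁ ↔ C.coordUMinus x = 0 ∧ C.coordVPlus x = 0 := by
  rw [planeS₁, Submodule.mem_span_pair]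
  constructor
  · rintro ⟨s, t, rfl⟩
    simp [(C.coordUMinus_basis hAlt).1, (C.coordUMinus_basis hAlt).2.1,
      (C.coordVPlus_basis hAlt).1, (C.coordVPlus_basis hAlt).2.1]
  · rintro ⟨hc, hd⟩
    refine ⟨C.coordUPlus x, C.coordVMinus x, ?_⟩
    conv_rhs => rw [← C.ofCoords_coords hdim hAlt x, hc, hd]
    simp [ofCoords]

theorem mem_planeS₂_iff (hdim : Module.finrank ℝ V = 4) (hAlt : ω.IsAlt) {x : V} :
    x ∈ C.planeS₂ ↔ C.coordUPlus x = 0 ∧ C.coordVMinus x = 0 := by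
  rw [planeS₂, Submodule.mem_span_pair]
  constructor
  · rintro ⟨s, t, rfl⟩
    simp [(C.coordUPlus_basis hAlt).2.2, (C.coordVMinus_basis hAlt).2.2]
  · rintro ⟨hc, hd⟩
    refine ⟨C.coordUMinus x, C.coordVPlus x, ?_⟩
    conv_rhs => rw [← C.ofCoords_coords hdim hAlt x, hc, hd]
    simp [ofCoords]

theorem mem_planeZero_iff (hdim : Module.finrank ℝ V = 4) (hAlt : ω.IsAlt) {x : V} :
    x ∈ C.planeZero ↔ C.coordUPlus x = 0 ∧ C.coordUMinus x = 0 := by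
  rw [planeZero, Submodule.mem_span_pair]
  constructor
  · rintro ⟨s, t, rfl⟩
    simp [C.coordUPlus_basis hAlt, C.coordUMinus_basis hAlt]
  · rintro ⟨hc, hd⟩
    refine ⟨C.coordVPlus x, C.coordVMinus x, ?_⟩
    conv_rhs => rw [← C.ofCoords_coords hdim hAlt x, hc, hd]
    simp [ofCoords, add_comm]

theorem mem_planeInfty_iff (hdim : Module.finrank ℝ V = 4) (hAlt : ω.IsAlt) {x : V} :
    x ∈ C.planeInfty ↔ C.coordVMinus x = 0 ∧ C.coordVPlus x = 0 := by
  rw [planeInfty, Submodule.mem_span_pair]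
  constructor
  · rintro ⟨s, t, rfl⟩
    simp [C.coordVMinus_basis hAlt, C.coordVPlus_basis hAlt]
  · rintro ⟨hc, hd⟩
    refine ⟨C.coordUPlus x, C.coordUMinus x, ?_⟩
    conv_rhs => rw [← C.ofCoords_coords hdim hAlt x, hc, hd]
    simp [ofCoords]

theorem isCompl_planeZero_planeInfty (hdim : Module.finrank ℝ V = 4) (hAlt : ω.IsAlt) :
    IsCompl C.planeZero C.planeInfty := by
  constructor
  · rw [Submodule.disjoint_def]
    intro x hx hy
    rw [C.mem_planeZero_iff hdim hAlt] at hx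
    rw [C.mem_planeInfty_iff hdim hAlt] at hy
    exact C.eq_zero_of_coords hdim hAlt hx.1 hy.1 hx.2 hy.2
  · rw [codisjoint_iff, eq_top_iff]
    intro x _
    rw [← C.ofCoords_coords hdim hAlt x, Submodule.mem_sup]
    refine ⟨C.coordVPlus x • C.vPlus + C.coordVMinus x • C.vMinus,
      Submodule.mem_span_pair.2 ⟨_, _, rfl⟩,
      C.coordUPlus x • C.uPlus + C.coordUMinus x • C.uMinus,
      Submodule.mem_span_pair.2 ⟨_, _, rfl⟩, ?_⟩
    rw [ofCoords]
    abel

/-- The opposite of the quadratic form of the splitting `V = P₀ ⊕ P_∞`, in coordinates. -/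
def quad (x : V) : ℝ :=
  C.coordUPlus x * C.coordVMinus x + C.coordUMinus x * C.coordVPlus x

theorem splittingForm_eq (hdim : Module.finrank ℝ V = 4) (hAlt : ω.IsAlt)
    (h : IsCompl C.planeZero C.planeInfty) (x : V) :
    splittingForm ω h x = -C.quad x := by
  set y := C.planeZero.projection C.planeInfty h x with hy
  set z := C.planeInfty.projection C.planeZero h.symm x with hz
  have hyz : y + z = x := Submodule.projection_add_projection_eq_self h x
  have hy' := (C.mem_planeZero_iff hdim hAlt).1 (Submodule.projection_apply_mem h x)
  have hz' := (C.mem_planeInfty_iff hdim hAlt).1 (Submodule.projection_apply_mem h.symm x)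
  rw [← hy] at hy'
  rw [← hz] at hz'
  have : splittingForm ω h x = ω y z := rfl
  rw [this, C.form_eq_coords hdim hAlt, quad, ← hyz]
  simp only [map_add, hy'.1, hy'.2, hz'.1, hz'.2]
  ring

/-- On bases of Lagrangian planes, this vanishes exactly for the planes of the Einstein torus of
the splitting `V = S₁ ⊕ S₂`. -/
def torusForm (x y : V) : ℝ :=
  C.coordUPlus x * C.coordVMinus y - C.coordVMinus x * C.coordUPlus y

/-- Four times the Gram determinant of the quadratic form `quad`. -/
def stemDet (x y : V) : ℝ :=
  4 * (C.quad x * C.quad y) -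
    (C.coordUPlus x * C.coordVMinus y + C.coordVMinus x * C.coordUPlus y +
      (C.coordUMinus x * C.coordVPlus y + C.coordVPlus x * C.coordUMinus y)) ^ 2

theorem torusForm_comb (x y : V) (α β γ δ : ℝ) :
    C.torusForm (α • x + β • y) (γ • x + δ • y) = (α * δ - β * γ) * C.torusForm x y := by
  simp only [torusForm, map_add, map_smul, smul_eq_mul]
  ring

/-- A Gram determinant scales by the square of the change-of-basis determinant, so its sign depends
only on the plane and not on the frame. -/
theorem stemDet_comb (x y : V) (α β γ δ : ℝ) :
    C.stemDet (α • x + β • y) (γ • x + δ • y) = (α * δ - β * γ) ^ 2 * C.stemDet x y := by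
  simp only [stemDet, quad, map_add, map_smul, smul_eq_mul]
  ring

theorem torusForm_eq_zero_of_mem (hdim : Module.finrank ℝ V = 4) (hAlt : ω.IsAlt) (x : V) {y : V}
    (hy : y ∈ C.planeS₂) : C.torusForm x y = 0 := by
  rw [C.mem_planeS₂_iff hdim hAlt] at hy
  simp [torusForm, hy.1, hy.2]

theorem stemDet_of_mem (hdim : Module.finrank ℝ V = 4) (hAlt : ω.IsAlt) {x y : V}
    (hx : x ∈ C.planeS₁) (hy : y ∈ C.planeS₂) : C.stemDet x y = 4 * (C.quad x * C.quad y) := by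
  rw [C.mem_planeS₁_iff hdim hAlt] at hx
  rw [C.mem_planeS₂_iff hdim hAlt] at hy
  simp [stemDet, hx.1, hx.2, hy.1, hy.2]

theorem linearIndependent_of_mem (hdim : Module.finrank ℝ V = 4) (hAlt : ω.IsAlt) {x y : V}
    (hx : x ∈ C.planeS₁) (hy : y ∈ C.planeS₂) (hx0 : x ≠ 0) (hy0 : y ≠ 0) :
    LinearIndependent ℝ ![x, y] := by
  rw [C.mem_planeS₁_iff hdim hAlt] at hx
  rw [C.mem_planeS₂_iff hdim hAlt] at hy
  rw [LinearIndependent.pair_iff]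
  intro s t h
  have hs : s • x = 0 := by
    have h' : s • x = -(t • y) := eq_neg_of_add_eq_zero_left h
    refine C.eq_zero_of_coords hdim hAlt ?_ ?_ (by simp [hx.1]) (by simp [hx.2])
    · rw [h']; simp [hy.1]
    · rw [h']; simp [hy.2]
  rw [hs, zero_add] at h
  exact ⟨(smul_eq_zero.1 hs).resolve_right hx0, (smul_eq_zero.1 h).resolve_right hy0⟩

theorem isLagrangian_of_mem (hdim : Module.finrank ℝ V = 4) (hAlt : ω.IsAlt) {x y : V}
    (hx : x ∈ C.planeS₁) (hy : y ∈ C.planeS₂) (hx0 : x ≠ 0) (hy0 : y ≠ 0) :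
    IsLagrangian ω (Submodule.span ℝ {x, y}) := by
  have hli := C.linearIndependent_of_mem hdim hAlt hx hy hx0 hy0
  refine ⟨?_, ?_⟩
  · have := finrank_span_eq_card hli
    rwa [Matrix.range_cons_cons_empty, Fintype.card_fin] at this
  · rw [C.mem_planeS₁_iff hdim hAlt] at hx
    rw [C.mem_planeS₂_iff hdim hAlt] at hy
    intro z hz z' hz'
    obtain ⟨s, t, rfl⟩ := Submodule.mem_span_pair.1 hz
    obtain ⟨s', t', rfl⟩ := Submodule.mem_span_pair.1 hz'
    rw [C.form_eq_coords hdim hAlt]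
    simp only [map_add, map_smul, smul_eq_mul, hx.1, hx.2, hy.1, hy.2]
    ring

end LightlikeQuadrilateral

end EinsteinUniverse

/-! ### Frames of Lagrangian planes, and equations for the stem and its closure -/

namespace EinsteinUniverse

variable {V : Type*} [NormedAddCommGroup V] [NormedSpace ℝ V]

theorem finrank_span_pair_le (x y : V) : Module.finrank ℝ (Submodule.span ℝ {x, y}) ≤ 2 := by
  have h := finrank_range_le_card (R := ℝ) ![x, y]
  rwa [Matrix.range_cons_cons_empty, Fintype.card_fin] at h

theorem linearIndependent_of_isLagrangian {ω : LinearMap.BilinForm ℝ V} {x y : V}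
    (h : IsLagrangian ω (Submodule.span ℝ {x, y})) : LinearIndependent ℝ ![x, y] := by
  rw [linearIndependent_iff_card_eq_finrank_span, Matrix.range_cons_cons_empty, Fintype.card_fin]
  exact h.1.symm

theorem Ein.linearIndependent {ω : LinearMap.BilinForm ℝ V} {p : Ein ω} {x y : V}
    (hp : p.plane = Submodule.span ℝ {x, y}) : LinearIndependent ℝ ![x, y] :=
  linearIndependent_of_isLagrangian (ω := ω) (by rw [← hp]; exact p.2)

theorem span_pair_eq_of_linearIndependent {L : Submodule ℝ V} (hL : Module.finrank ℝ L = 2)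
    {x y : V} (hx : x ∈ L) (hy : y ∈ L) (h : LinearIndependent ℝ ![x, y]) :
    L = Submodule.span ℝ {x, y} := by
  have : FiniteDimensional ℝ L := Module.finite_of_finrank_eq_succ hL
  symm
  refine Submodule.eq_of_le_of_finrank_eq ?_ ?_
  · rw [Submodule.span_le]
    rintro z (rfl | rfl)
    exacts [hx, hy]
  · have := finrank_span_eq_card h
    rw [Matrix.range_cons_cons_empty, Fintype.card_fin] at this
    rw [this, hL]

theorem exists_comb_of_span_eq {x y w w' : V} (hxy : LinearIndependent ℝ ![x, y])
    (h : Submodule.span ℝ {x, y} = Submodule.span ℝ {w, w'}) :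
    ∃ α β γ δ : ℝ, x = α • w + β • w' ∧ y = γ • w + δ • w' ∧ α * δ - β * γ ≠ 0 := by
  have hx : x ∈ Submodule.span ℝ {w, w'} := h ▸ Submodule.subset_span (by simp)
  have hy : y ∈ Submodule.span ℝ {w, w'} := h ▸ Submodule.subset_span (by simp)
  obtain ⟨α, β, hx⟩ := Submodule.mem_span_pair.1 hx
  obtain ⟨γ, δ, hy⟩ := Submodule.mem_span_pair.1 hy
  -- If the determinant vanished, the Cramer combinations of `x` and `y` below would be zero;
  -- independence gives `α = β = 0`, hence `x = 0`.
  refine ⟨α, β, γ, δ, hx.symm, hy.symm, fun hdet => ?_⟩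
  rw [LinearIndependent.pair_iff] at hxy
  have h₁ : δ • x + (-β) • y = (α * δ - β * γ) • w := by rw [← hx, ← hy]; module
  have h₂ : (-γ) • x + α • y = (α * δ - β * γ) • w' := by rw [← hx, ← hy]; module
  rw [hdet, zero_smul] at h₁ h₂
  have hβ : β = 0 := by simpa using (hxy _ _ h₁).2
  have hα : α = 0 := (hxy _ _ h₂).2
  have := hxy 1 0 (by rw [← hx, hα, hβ]; simp)
  exact one_ne_zero this.1

namespace LightlikeQuadrilateral

variable {ω : LinearMap.BilinForm ℝ V} (C : LightlikeQuadrilateral ω)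

/-- A frame of a point of the Einstein torus of `V = S₁ ⊕ S₂` can be replaced by an adapted one,
up to a nonzero change of basis. -/
theorem exists_adapted_frame (hdim : Module.finrank ℝ V = 4) (hAlt : ω.IsAlt) {p : Ein ω}
    {x y : V} (hp : p.plane = Submodule.span ℝ {x, y}) (h : C.torusForm x y = 0) :
    ∃ w ∈ C.planeS₁, ∃ w' ∈ C.planeS₂, p.plane = Submodule.span ℝ {w, w'} := by
  have hli := Ein.linearIndependent hp
  have hx : x ∈ p.plane := hp ▸ Submodule.subset_span (by simp)
  have hy : y ∈ p.plane := hp ▸ Submodule.subset_span (by simp)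
  have hω := p.2.2 x hx y hy
  rw [C.form_eq_coords hdim hAlt] at hω
  -- On a Lagrangian plane the two area forms add up to zero, so both vanish as soon as `torusForm`
  -- does.
  have h' : C.coordUMinus x * C.coordVPlus y - C.coordVPlus x * C.coordUMinus y = 0 := by
    unfold torusForm at h
    linarith
  rw [LinearIndependent.pair_iff] at hli
  -- Two functionals with proportional restrictions to the plane have a common nonzero zero: the
  -- kernel vector of whichever restriction is nonzero, or `x` if both vanish.
  have key : ∀ f g : V →ₗ[ℝ] ℝ, f x * g y - g x * f y = 0 →
      ∃ z ∈ p.plane, z ≠ 0 ∧ f z = 0 ∧ g z = 0 := by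
    intro f g hfg
    by_cases hf : f x = 0 ∧ f y = 0
    · by_cases hg : g x = 0 ∧ g y = 0
      · exact ⟨x, hx, fun h0 => one_ne_zero (hli 1 0 (by simp [h0])).1, hf.1, hg.1⟩
      · refine ⟨g y • x + (-g x) • y,
          add_mem (Submodule.smul_mem _ _ hx) (Submodule.smul_mem _ _ hy), ?_, ?_, ?_⟩
        · intro h0
          have := hli _ _ h0
          exact hg ⟨by simpa using this.2, this.1⟩
        · simp [hf.1, hf.2]
        · simp only [map_add, map_smul, smul_eq_mul]; ring
    · refine ⟨f y • x + (-f x) • y,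
        add_mem (Submodule.smul_mem _ _ hx) (Submodule.smul_mem _ _ hy), ?_, ?_, ?_⟩
      · intro h0
        have := hli _ _ h0
        exact hf ⟨by simpa using this.2, this.1⟩
      · simp only [map_add, map_smul, smul_eq_mul]; ring
      · simp only [map_add, map_smul, smul_eq_mul]; linear_combination -hfg
  obtain ⟨w', hw', hw'0, ha, hb⟩ := key C.coordUPlus C.coordVMinus h
  obtain ⟨w, hw, hw0, hc, hd⟩ := key C.coordUMinus C.coordVPlus h'
  have hw₁ : w ∈ C.planeS₁ := (C.mem_planeS₁_iff hdim hAlt).2 ⟨hc, hd⟩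
  have hw₂ : w' ∈ C.planeS₂ := (C.mem_planeS₂_iff hdim hAlt).2 ⟨ha, hb⟩
  exact ⟨w, hw₁, w', hw₂, span_pair_eq_of_linearIndependent p.2.1 hw hw'
    (C.linearIndependent_of_mem hdim hAlt hw₁ hw₂ hw0 hw'0)⟩

/-- For an adapted basis `w, w'` of `L`, `quad` is definite on `L` iff
`quad w * quad w' > 0`. -/
theorem isTimelike_iff_of_mem (hdim : Module.finrank ℝ V = 4) (hAlt : ω.IsAlt) {p : Ein ω}
    {w w' : V} (hw : w ∈ C.planeS₁) (hw' : w' ∈ C.planeS₂)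
    (hp : p.plane = Submodule.span ℝ {w, w'}) :
    IsTimelike ω C.planeZero p.plane C.planeInfty ↔ 0 < C.quad w * C.quad w' := by
  have : FiniteDimensional ℝ V := Module.finite_of_finrank_eq_succ hdim
  have hli := Ein.linearIndependent hp
  rw [LinearIndependent.pair_iff] at hli
  have hw0 : w ≠ 0 := fun h0 => one_ne_zero (hli 1 0 (by simp [h0])).1
  have hw'0 : w' ≠ 0 := fun h0 => one_ne_zero (hli 0 1 (by simp [h0])).2
  have hwm : w ∈ p.plane := hp ▸ Submodule.subset_span (by simp)
  have hw'm : w' ∈ p.plane := hp ▸ Submodule.subset_span (by simp)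
  have hsplit := C.isCompl_planeZero_planeInfty hdim hAlt
  have hS := (C.mem_planeS₁_iff hdim hAlt).1 hw
  have hS' := (C.mem_planeS₂_iff hdim hAlt).1 hw'
  -- `S₁` and `S₂` are also orthogonal for `quad`, so an adapted frame diagonalises it.
  have hq : ∀ s t : ℝ, C.quad (s • w + t • w') = s ^ 2 * C.quad w + t ^ 2 * C.quad w' := by
    intro s t
    simp only [quad, map_add, map_smul, smul_eq_mul, hS.1, hS.2, hS'.1, hS'.2]
    ring
  have hfin : Module.finrank ℝ p.plane = 2 := p.2.1
  constructor
  · rintro ⟨h, -, -, hm⟩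
    rw [maslovIndex, abs_signature_eq_two_iff hfin] at hm
    rcases hm with hm | hm
    · have h₁ := hm ⟨w, hwm⟩ (by simpa using hw0)
      have h₂ := hm ⟨w', hw'm⟩ (by simpa using hw'0)
      rw [QuadraticMap.restrict_apply, C.splittingForm_eq hdim hAlt] at h₁ h₂
      exact mul_pos_of_neg_of_neg (by simpa using h₁) (by simpa using h₂)
    · have h₁ := hm ⟨w, hwm⟩ (by simpa using hw0)
      have h₂ := hm ⟨w', hw'm⟩ (by simpa using hw'0)
      rw [neg_apply, QuadraticMap.restrict_apply,
        C.splittingForm_eq hdim hAlt, neg_neg] at h₁ h₂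
      exact mul_pos h₁ h₂
  · intro hpos
    have hdef : (∀ z ∈ p.plane, z ≠ 0 → C.quad z < 0) ∨ (∀ z ∈ p.plane, z ≠ 0 → 0 < C.quad z) := by
      rcases mul_pos_iff.1 hpos with ⟨h₁, h₂⟩ | ⟨h₁, h₂⟩
      · right
        intro z hz hz0
        rw [hp] at hz
        obtain ⟨s, t, rfl⟩ := Submodule.mem_span_pair.1 hz
        rw [hq]
        by_cases hs : s = 0
        · have ht : t ≠ 0 := by rintro rfl; simp [hs] at hz0
          positivity
        · positivity
      · left
        intro z hz hz0
        rw [hp] at hz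
        obtain ⟨s, t, rfl⟩ := Submodule.mem_span_pair.1 hz
        rw [hq]
        by_cases hs : s = 0
        · have ht : t ≠ 0 := by rintro rfl; simp [hs] at hz0
          have : 0 < t ^ 2 := by positivity
          nlinarith [sq_nonneg s]
        · have : 0 < s ^ 2 := by positivity
          nlinarith [sq_nonneg t]
    -- `quad` vanishes on `P₀` and on `P_∞`, so definiteness on the plane already gives both
    -- transversality conditions.
    have hanis : ∀ z ∈ p.plane, C.quad z = 0 → z = 0 := by
      intro z hz hz0
      by_contra hne
      rcases hdef with h | h
      · exact (h z hz hne).ne hz0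
      · exact (h z hz hne).ne' hz0
    have hd₁ : Disjoint C.planeZero p.plane := by
      rw [Submodule.disjoint_def]
      intro z hz hzp
      rw [C.mem_planeZero_iff hdim hAlt] at hz
      exact hanis z hzp (by simp [quad, hz.1, hz.2])
    have hd₂ : Disjoint p.plane C.planeInfty := by
      rw [Submodule.disjoint_def]
      intro z hzp hz
      rw [C.mem_planeInfty_iff hdim hAlt] at hz
      exact hanis z hzp (by simp [quad, hz.1, hz.2])
    have hsum := Submodule.finrank_add_eq_of_isCompl hsplit
    have h₀ : Module.finrank ℝ C.planeZero ≤ 2 := finrank_span_pair_le _ _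
    have h₁ : Module.finrank ℝ C.planeInfty ≤ 2 := finrank_span_pair_le _ _
    refine ⟨hsplit, (Submodule.isCompl_iff_disjoint _ _ (by omega)).2 hd₁,
      (Submodule.isCompl_iff_disjoint _ _ (by omega)).2 hd₂, ?_⟩
    rw [maslovIndex, abs_signature_eq_two_iff hfin]
    rcases hdef with h | h
    · left
      intro z hz
      rw [QuadraticMap.restrict_apply, C.splittingForm_eq hdim hAlt]
      exact neg_pos.2 (h z z.2 (by simpa using hz))
    · right
      intro z hz
      rw [neg_apply, QuadraticMap.restrict_apply,
        C.splittingForm_eq hdim hAlt, neg_neg]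
      exact h z z.2 (by simpa using hz)

/-- A point is in the stem iff a (any) frame of it is in the torus with positive `stemDet`. -/
theorem mem_stem_iff (hdim : Module.finrank ℝ V = 4) (hAlt : ω.IsAlt) {p : Ein ω}
    {x y : V} (hp : p.plane = Submodule.span ℝ {x, y}) :
    p ∈ C.stem ↔ C.torusForm x y = 0 ∧ 0 < C.stemDet x y := by
  have hli := Ein.linearIndependent hp
  constructor
  · rintro ⟨⟨w, hw, w', hw', hpw⟩, ht⟩
    rw [C.isTimelike_iff_of_mem hdim hAlt hw hw' hpw] at ht
    obtain ⟨α, β, γ, δ, rfl, rfl, hdet⟩ := exists_comb_of_span_eq hli (hp.symm.trans hpw)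
    rw [torusForm_comb, stemDet_comb, C.torusForm_eq_zero_of_mem hdim hAlt w hw',
      C.stemDet_of_mem hdim hAlt hw hw']
    exact ⟨mul_zero _, by positivity⟩
  · rintro ⟨h, hpos⟩
    obtain ⟨w, hw, w', hw', hpw⟩ := C.exists_adapted_frame hdim hAlt hp h
    refine ⟨⟨w, hw, w', hw', hpw⟩, ?_⟩
    rw [C.isTimelike_iff_of_mem hdim hAlt hw hw' hpw]
    obtain ⟨α, β, γ, δ, rfl, rfl, hdet⟩ := exists_comb_of_span_eq hli (hp.symm.trans hpw)
    rw [stemDet_comb, C.stemDet_of_mem hdim hAlt hw hw'] at hpos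
    have := pos_of_mul_pos_right hpos (sq_nonneg _)
    linarith

/-- The closed stem is closed under degenerating `stemDet`. -/
theorem mem_closedStem_of_nonneg (hdim : Module.finrank ℝ V = 4) (hAlt : ω.IsAlt) {p : Ein ω}
    {w w' : V} (hw : w ∈ C.planeS₁) (hw' : w' ∈ C.planeS₂)
    (hp : p.plane = Submodule.span ℝ {w, w'}) (h : 0 ≤ C.quad w * C.quad w') :
    p ∈ C.closedStem := by
  have hli := Ein.linearIndependent hp
  have hS := (C.mem_planeS₁_iff hdim hAlt).1 hw
  have hS' := (C.mem_planeS₂_iff hdim hAlt).1 hw'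
  have hw0 : w ≠ 0 := hli.ne_zero 0
  have hw'0 : w' ≠ 0 := hli.ne_zero 1
  set a := C.coordUPlus w with ha
  set b := C.coordVMinus w with hb
  set c := C.coordUMinus w' with hc
  set d := C.coordVPlus w' with hd
  have hwe : w = C.ofCoords a b 0 0 := by
    conv_lhs => rw [← C.ofCoords_coords hdim hAlt w, hS.1, hS.2]
  have hwe' : w' = C.ofCoords 0 0 c d := by
    conv_lhs => rw [← C.ofCoords_coords hdim hAlt w', hS'.1, hS'.2]
  have hq : 0 ≤ (a * b) * (c * d) := by
    simpa [quad, hS.1, hS.2, hS'.1, hS'.2] using h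
  -- `σ` is a common sign of `a * b` and `c * d`. The perturbation must make both strictly of this
  -- sign, even where they are zero.
  obtain ⟨σ, hσ, h₁, h₂⟩ : ∃ σ : ℝ, σ ^ 2 = 1 ∧ 0 ≤ σ * (a * b) ∧ 0 ≤ σ * (c * d) := by
    rcases mul_nonneg_iff.1 hq with ⟨h₁, h₂⟩ | ⟨h₁, h₂⟩
    · exact ⟨1, by norm_num, by simpa, by simpa⟩
    · exact ⟨-1, by norm_num, by simpa, by simpa⟩
  -- directions along which `σ * (a * b)` becomes positive
  have hdir : ∀ a b : ℝ, 0 ≤ σ * (a * b) →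
      ∃ k l : ℝ, ∀ ε : ℝ, 0 < ε → 0 < σ * ((a + ε * k) * (b + ε * l)) := by
    have hdir' : ∀ a b : ℝ, 0 ≤ a * b →
        ∃ k l : ℝ, ∀ ε : ℝ, 0 < ε → 0 < (a + ε * k) * (b + ε * l) := by
      intro a b hab
      rcases mul_nonneg_iff.1 hab with ⟨h₁, h₂⟩ | ⟨h₁, h₂⟩
      · exact ⟨1, 1, fun ε hε => by positivity⟩
      · exact ⟨-1, -1, fun ε hε => mul_pos_of_neg_of_neg (by linarith) (by linarith)⟩
    intro a b hab
    -- The sign is absorbed into the first factor and recovered from `σ ^ 2 = 1`.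
    obtain ⟨k, l, hkl⟩ := hdir' (σ * a) b (by linarith)
    refine ⟨σ * k, l, fun ε hε => ?_⟩
    have h2 : σ * ((a + ε * (σ * k)) * (b + ε * l)) =
      (σ * a + ε * (σ ^ 2 * k)) * (b + ε * l) := by ring
    rw [h2, hσ, one_mul]
    exact hkl ε hε
  obtain ⟨k, l, hkl⟩ := hdir a b h₁
  obtain ⟨m, n, hmn⟩ := hdir c d h₂
  let X : ℝ → V := fun ε => C.ofCoords (a + ε * k) (b + ε * l) 0 0
  let Y : ℝ → V := fun ε => C.ofCoords 0 0 (c + ε * m) (d + ε * n)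
  have hX : ∀ ε, X ε ∈ C.planeS₁ := fun ε => (C.mem_planeS₁_iff hdim hAlt).2
    ⟨C.coordUMinus_ofCoords hAlt _ _ _ _, C.coordVPlus_ofCoords hAlt _ _ _ _⟩
  have hY : ∀ ε, Y ε ∈ C.planeS₂ := fun ε => (C.mem_planeS₂_iff hdim hAlt).2
    ⟨C.coordUPlus_ofCoords hAlt _ _ _ _, C.coordVMinus_ofCoords hAlt _ _ _ _⟩
  have hX0 : X 0 = w := by simp [X, ← hwe]
  have hY0 : Y 0 = w' := by simp [Y, ← hwe']
  have hqX : ∀ ε, C.quad (X ε) = (a + ε * k) * (b + ε * l) := fun ε => by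
    simp [quad, X, C.coordUPlus_ofCoords hAlt, C.coordVMinus_ofCoords hAlt,
      C.coordUMinus_ofCoords hAlt, C.coordVPlus_ofCoords hAlt]
  have hqY : ∀ ε, C.quad (Y ε) = (c + ε * m) * (d + ε * n) := fun ε => by
    simp [quad, Y, C.coordUPlus_ofCoords hAlt, C.coordVMinus_ofCoords hAlt,
      C.coordUMinus_ofCoords hAlt, C.coordVPlus_ofCoords hAlt]
  have hpos : ∀ ε, 0 < ε → 0 < C.quad (X ε) * C.quad (Y ε) := by
    intro ε hε
    rw [hqX, hqY]
    have := mul_pos (hkl ε hε) (hmn ε hε)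
    have h2 : σ * ((a + ε * k) * (b + ε * l)) * (σ * ((c + ε * m) * (d + ε * n))) =
      σ ^ 2 * (((a + ε * k) * (b + ε * l)) * ((c + ε * m) * (d + ε * n))) := by ring
    rwa [h2, hσ, one_mul] at this
  -- The parameter is restricted to `ε ≥ 0`: at `0` the frame is the given one, and for `ε > 0`
  -- neither vector vanishes because `quad` does not vanish on it.
  have hLag : ∀ ε : Set.Ici (0 : ℝ), IsLagrangian ω (Submodule.span ℝ {X ε, Y ε}) := by
    rintro ⟨ε, hε⟩
    rcases (Set.mem_Ici.1 hε).eq_or_lt with rfl | hε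
    · simp only [hX0, hY0]
      exact hp ▸ p.2
    · refine C.isLagrangian_of_mem hdim hAlt (hX _) (hY _) ?_ ?_
      · intro h0
        have := hpos ε hε
        simp [h0, quad] at this
      · intro h0
        have := hpos ε hε
        simp [h0, quad] at this
  let F : Set.Ici (0 : ℝ) → LagrangianFrame ω := fun ε => ⟨(X ε, Y ε), hLag ε⟩
  have hF : Continuous F := by
    refine Continuous.subtype_mk ?_ _
    simp only [X, Y, ofCoords]
    fun_prop
  have hE : Continuous fun ε => (F ε).toEin :=
    (continuous_coinduced_rng (f := LagrangianFrame.toEin)).comp hF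
  have hp0 : (F ⟨0, Set.self_mem_Ici⟩).toEin = p := by
    refine Subtype.ext ?_
    change Submodule.span ℝ {X 0, Y 0} = p.plane
    rw [hX0, hY0, hp]
  rw [← hp0]
  have hcl : (⟨0, Set.self_mem_Ici⟩ : Set.Ici (0 : ℝ)) ∈ closure {ε : Set.Ici (0 : ℝ) | 0 < (ε : ℝ)} := by
    rw [mem_closure_iff_seq_limit]
    refine ⟨fun n => ⟨1 / ((n : ℝ) + 1), Set.mem_Ici.2 (by positivity)⟩,
      fun n => by simp only [Set.mem_ofPred_eq]; positivity, ?_⟩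
    rw [tendsto_subtype_rng]
    exact tendsto_one_div_add_atTop_nhds_zero_nat
  refine closure_mono ?_ (image_closure_subset_closure_image hE ⟨_, hcl, rfl⟩)
  rintro _ ⟨ε, hε, rfl⟩
  have hplane : (F ε).toEin.plane = Submodule.span ℝ {X ε, Y ε} := rfl
  exact ⟨⟨_, hX ε, _, hY ε, hplane⟩,
    (C.isTimelike_iff_of_mem hdim hAlt (hX ε) (hY ε) hplane).2 (hpos ε hε)⟩

theorem continuous_torusForm (hdim : Module.finrank ℝ V = 4) :
    Continuous fun z : V × V => C.torusForm z.1 z.2 := by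
  have : FiniteDimensional ℝ V := Module.finite_of_finrank_eq_succ hdim
  have ha := C.coordUPlus.continuous_of_finiteDimensional
  have hb := C.coordVMinus.continuous_of_finiteDimensional
  unfold torusForm
  fun_prop

theorem continuous_stemDet (hdim : Module.finrank ℝ V = 4) :
    Continuous fun z : V × V => C.stemDet z.1 z.2 := by
  have : FiniteDimensional ℝ V := Module.finite_of_finrank_eq_succ hdim
  have ha := C.coordUPlus.continuous_of_finiteDimensional
  have hb := C.coordVMinus.continuous_of_finiteDimensional
  have hc := C.coordUMinus.continuous_of_finiteDimensional
  have hd := C.coordVPlus.continuous_of_finiteDimensional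
  unfold stemDet quad
  fun_prop

theorem mem_closedStem_iff (hdim : Module.finrank ℝ V = 4) (hAlt : ω.IsAlt) {p : Ein ω}
    {x y : V} (hp : p.plane = Submodule.span ℝ {x, y}) :
    p ∈ C.closedStem ↔ C.torusForm x y = 0 ∧ 0 ≤ C.stemDet x y := by
  have hli := Ein.linearIndependent hp
  constructor
  · intro h
    -- the condition does not depend on the frame and is closed on frames
    let Z : Set (Ein ω) := {q | ∀ x y : V, q.plane = Submodule.span ℝ {x, y} →
      C.torusForm x y = 0 ∧ 0 ≤ C.stemDet x y}
    have hZ : IsClosed Z := by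
      rw [← isOpen_compl_iff, isOpen_coinduced, ← Set.preimage_compl.symm, isOpen_compl_iff]
      have : LagrangianFrame.toEin ⁻¹' Z = {f : LagrangianFrame ω |
          C.torusForm f.1.1 f.1.2 = 0 ∧ 0 ≤ C.stemDet f.1.1 f.1.2} := by
        ext f
        refine ⟨fun hf => hf _ _ rfl, fun hf x y hxy => ?_⟩
        have hli := Ein.linearIndependent hxy
        obtain ⟨α, β, γ, δ, rfl, rfl, hdet⟩ := exists_comb_of_span_eq hli hxy.symm
        rw [torusForm_comb, stemDet_comb, hf.1]
        exact ⟨mul_zero _, mul_nonneg (sq_nonneg _) hf.2⟩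
      rw [this]
      exact (isClosed_eq ((C.continuous_torusForm hdim).comp continuous_subtype_val)
        continuous_const).inter (isClosed_le continuous_const
          ((C.continuous_stemDet hdim).comp continuous_subtype_val))
    have hsub : C.stem ⊆ Z := fun q hq x y hxy =>
      ((C.mem_stem_iff hdim hAlt hxy).1 hq).imp id le_of_lt
    exact closure_minimal hsub hZ h x y hp
  · rintro ⟨h, hpos⟩
    obtain ⟨w, hw, w', hw', hpw⟩ := C.exists_adapted_frame hdim hAlt hp h
    refine C.mem_closedStem_of_nonneg hdim hAlt hw hw' hpw ?_
    obtain ⟨α, β, γ, δ, rfl, rfl, hdet⟩ := exists_comb_of_span_eq hli (hp.symm.trans hpw)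
    rw [stemDet_comb, C.stemDet_of_mem hdim hAlt hw hw'] at hpos
    have := nonneg_of_mul_nonneg_right hpos (by positivity)
    linarith

end LightlikeQuadrilateral

end EinsteinUniverse

/-! ### The stem boundary lies in the wings -/

namespace EinsteinUniverse

variable {V : Type*} [NormedAddCommGroup V] [NormedSpace ℝ V]

namespace LightlikeQuadrilateral

variable {ω : LinearMap.BilinForm ℝ V} (C : LightlikeQuadrilateral ω)

/-- For an adapted frame, `stemDet` is four times the product of the four coordinates. When one is
zero, `w` or `w'` spans an edge photon `u₊`, `u₋`, `v₊` or `v₋`; there `t * s = 0`, which satisfies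
the sign condition of either wing. -/
theorem stemBoundary_subset_wings (hdim : Module.finrank ℝ V = 4) (hAlt : ω.IsAlt) :
    C.stemBoundary ⊆ C.wings := by
  rintro p ⟨hcl, hst⟩
  obtain ⟨x, y, hxy⟩ : ∃ x y : V, p.plane = Submodule.span ℝ {x, y} := by
    have : FiniteDimensional ℝ p.plane := Module.finite_of_finrank_eq_succ p.2.1
    let b := Module.finBasisOfFinrankEq ℝ p.plane p.2.1
    refine ⟨b 0, b 1, span_pair_eq_of_linearIndependent p.2.1 (b 0).2 (b 1).2 ?_⟩
    have hb : ![(b 0 : V), b 1] = p.plane.subtype ∘ b := by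
      ext i
      fin_cases i <;> rfl
    rw [hb]
    exact b.linearIndependent.map' p.plane.subtype p.plane.ker_subtype
  have ht := ((C.mem_closedStem_iff hdim hAlt hxy).1 hcl).1
  obtain ⟨w, hw, w', hw', hp⟩ := C.exists_adapted_frame hdim hAlt hxy ht
  have hzero : C.stemDet w w' = 0 := by
    rw [C.mem_stem_iff hdim hAlt hp, C.torusForm_eq_zero_of_mem hdim hAlt w hw'] at hst
    have := ((C.mem_closedStem_iff hdim hAlt hp).1 hcl).2
    by_contra hne
    exact hst ⟨rfl, lt_of_le_of_ne this (Ne.symm hne)⟩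
  have hli := Ein.linearIndependent hp
  have hw0 : w ≠ 0 := hli.ne_zero 0
  have hw'0 : w' ≠ 0 := hli.ne_zero 1
  have hwm : w ∈ p.plane := hp ▸ Submodule.subset_span (by simp)
  have hw'm : w' ∈ p.plane := hp ▸ Submodule.subset_span (by simp)
  have hS := (C.mem_planeS₁_iff hdim hAlt).1 hw
  have hS' := (C.mem_planeS₂_iff hdim hAlt).1 hw'
  have hwe := C.ofCoords_coords hdim hAlt w
  have hwe' := C.ofCoords_coords hdim hAlt w'
  rw [hS.1, hS.2] at hwe
  rw [hS'.1, hS'.2] at hwe'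
  rw [C.stemDet_of_mem hdim hAlt hw hw', quad, quad, hS.1, hS'.1] at hzero
  have hcases : (C.coordUPlus w = 0 ∨ C.coordVMinus w = 0) ∨
      (C.coordUMinus w' = 0 ∨ C.coordVPlus w' = 0) := by
    simpa using hzero
  have hplus : ∀ (t s : ℝ) (z : V), z ≠ 0 → z ∈ p.plane → t * s = 0 →
      t • C.uPlus + s • C.vPlus = z → p ∈ C.wingPlus := by
    rintro t s z hz hzp hts rfl
    refine Set.mem_biUnion ⟨t, s, hz, hts.ge, rfl⟩ ?_
    rwa [photon, Set.mem_ofPred_eq, Projectivization.submodule_mk,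
      Submodule.span_singleton_le_iff_mem]
  have hminus : ∀ (t s : ℝ) (z : V), z ≠ 0 → z ∈ p.plane → t * s = 0 →
      t • C.uMinus + s • C.vMinus = z → p ∈ C.wingMinus := by
    rintro t s z hz hzp hts rfl
    refine Set.mem_biUnion ⟨t, s, hz, hts.le, rfl⟩ ?_
    rwa [photon, Set.mem_ofPred_eq, Projectivization.submodule_mk,
      Submodule.span_singleton_le_iff_mem]
  rcases hcases with (h | h) | (h | h)
  · rw [h] at hwe
    exact Or.inr (hminus 0 (C.coordVMinus w) w hw0 hwm (zero_mul _) (by simpa [ofCoords] using hwe))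
  · rw [h] at hwe
    exact Or.inl (hplus (C.coordUPlus w) 0 w hw0 hwm (mul_zero _) (by simpa [ofCoords] using hwe))
  · rw [h] at hwe'
    exact Or.inl (hplus 0 (C.coordVPlus w') w' hw'0 hw'm (zero_mul _)
      (by simpa [ofCoords] using hwe'))
  · rw [h] at hwe'
    exact Or.inr (hminus (C.coordUMinus w') 0 w' hw'0 hw'm (mul_zero _)
      (by simpa [ofCoords] using hwe'))

theorem closedStem_subset (hdim : Module.finrank ℝ V = 4) (hAlt : ω.IsAlt) :
    C.closedStem ⊆ C.stem ∪ C.wings := by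
  intro p hp
  by_cases h : p ∈ C.stem
  · exact Or.inl h
  · exact Or.inr (C.stemBoundary_subset_wings hdim hAlt ⟨hp, h⟩)

theorem torusForm_add_right (x y z : V) :
    C.torusForm x (y + z) = C.torusForm x y + C.torusForm x z := by
  simp only [torusForm, map_add]; ring

theorem torusForm_smul_right (x y : V) (r : ℝ) :
    C.torusForm x (r • y) = r * C.torusForm x y := by
  simp only [torusForm, map_smul, smul_eq_mul]; ring

theorem torusForm_add_left (x y z : V) :
    C.torusForm (x + y) z = C.torusForm x z + C.torusForm y z := by
  simp only [torusForm, map_add]; ring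

theorem torusForm_smul_left (x y : V) (r : ℝ) :
    C.torusForm (r • x) y = r * C.torusForm x y := by
  simp only [torusForm, map_smul, smul_eq_mul]; ring

theorem stemDet_smul_right (x y : V) (r : ℝ) :
    C.stemDet x (r • y) = r ^ 2 * C.stemDet x y := by
  simpa using C.stemDet_comb x y 1 0 0 r

/-! ### Two surfaces: leaving the intersection of the stems -/

section Pair

variable (C₁ C₂ : LightlikeQuadrilateral ω)

/-- A path in the intersection of the two tori that leaves the first stem meets the boundary of
one stem inside the other closed stem. -/
theorem exists_mem_closedStems_of_path (hdim : Module.finrank ℝ V = 4) (hAlt : ω.IsAlt)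
    {x y : ℝ → V} (hx : Continuous x) (hy : Continuous y)
    (hxS : ∀ t, x t ∈ C₁.planeS₁) (hyS : ∀ t, y t ∈ C₁.planeS₂)
    (hx0 : ∀ t, x t ≠ 0) (hy0 : ∀ t, y t ≠ 0) (hT : ∀ t, C₂.torusForm (x t) (y t) = 0)
    (h0 : C₁.stemDet (x 0) (y 0) = 0) (h1 : 0 < C₁.stemDet (x 1) (y 1))
    (h2 : 0 < C₂.stemDet (x 1) (y 1)) :
    ∃ p, p ∈ C₁.closedStem ∧ p ∈ C₂.closedStem ∧ (p ∉ C₁.stem ∨ p ∉ C₂.stem) := by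
  -- At a zero of the minimum both determinants are nonnegative and one is zero.
  let f : ℝ → ℝ := fun t => min (C₁.stemDet (x t) (y t)) (C₂.stemDet (x t) (y t))
  have hf : Continuous f :=
    ((C₁.continuous_stemDet hdim).comp (hx.prodMk hy)).min
      ((C₂.continuous_stemDet hdim).comp (hx.prodMk hy))
  obtain ⟨t, -, ht⟩ : (0 : ℝ) ∈ f '' Set.Icc 0 1 :=
    intermediate_value_Icc zero_le_one hf.continuousOn
      ⟨(min_le_left _ _).trans h0.le, (lt_min h1 h2).le⟩
  let p : Ein ω :=
    ⟨Submodule.span ℝ {x t, y t}, C₁.isLagrangian_of_mem hdim hAlt (hxS t) (hyS t) (hx0 t) (hy0 t)⟩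
  have hp : p.plane = Submodule.span ℝ {x t, y t} := rfl
  have hT₁ := C₁.torusForm_eq_zero_of_mem hdim hAlt (x t) (hyS t)
  refine ⟨p, (C₁.mem_closedStem_iff hdim hAlt hp).2 ⟨hT₁, ht ▸ min_le_left _ _⟩,
    (C₂.mem_closedStem_iff hdim hAlt hp).2 ⟨hT t, ht ▸ min_le_right _ _⟩, ?_⟩
  rw [C₁.mem_stem_iff hdim hAlt hp, C₂.mem_stem_iff hdim hAlt hp]
  by_contra! h
  exact (lt_min h.1.2 h.2.2).ne' ht

/-- The second `torusForm` restricts to a bilinear form `B` on `S₁ × S₂` with matrix `α, β, γ, δ`.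
Given the common point `(w, w')` with `B(w, w') = 0`, a path in the zero set of `B` is needed that
reaches a degenerate line. If `w` or `w'` is in a kernel of `B`, the other vector moves freely;
otherwise `w` moves towards `v₋` and `w'` follows as the annihilator of the moving vector. -/
theorem exists_mem_closedStems_of_stems_meet (hdim : Module.finrank ℝ V = 4) (hAlt : ω.IsAlt)
    (h : (C₁.stem ∩ C₂.stem).Nonempty) :
    ∃ p, p ∈ C₁.closedStem ∧ p ∈ C₂.closedStem ∧ (p ∉ C₁.stem ∨ p ∉ C₂.stem) := by
  obtain ⟨p, hp₁, hp₂⟩ := h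
  obtain ⟨w, hw, w', hw', hp⟩ := hp₁.1
  have hG₁ := ((C₁.mem_stem_iff hdim hAlt hp).1 hp₁).2
  obtain ⟨hT, hG₂⟩ := (C₂.mem_stem_iff hdim hAlt hp).1 hp₂
  have hli := Ein.linearIndependent hp
  have hw0 : w ≠ 0 := hli.ne_zero 0
  have hw'0 : w' ≠ 0 := hli.ne_zero 1
  obtain ⟨a, b, rfl⟩ := Submodule.mem_span_pair.1 hw
  obtain ⟨c, d, rfl⟩ := Submodule.mem_span_pair.1 hw'
  have hquad : ∀ a b : ℝ, C₁.quad (a • C₁.uPlus + b • C₁.vMinus) = a * b := by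
    intro a b
    simp [quad, C₁.coordUPlus_basis hAlt, C₁.coordVMinus_basis hAlt, C₁.coordUMinus_basis hAlt]
  have hquad' : ∀ c d : ℝ, C₁.quad (c • C₁.uMinus + d • C₁.vPlus) = c * d := by
    intro c d
    simp [quad, C₁.coordUPlus_basis hAlt, C₁.coordUMinus_basis hAlt, C₁.coordVPlus_basis hAlt]
  have hmem : ∀ a b : ℝ, a • C₁.uPlus + b • C₁.vMinus ∈ C₁.planeS₁ :=
    fun a b => Submodule.mem_span_pair.2 ⟨a, b, rfl⟩
  have hmem' : ∀ c d : ℝ, c • C₁.uMinus + d • C₁.vPlus ∈ C₁.planeS₂ :=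
    fun c d => Submodule.mem_span_pair.2 ⟨c, d, rfl⟩
  have hne : ∀ a b : ℝ, b ≠ 0 → a • C₁.uPlus + b • C₁.vMinus ≠ 0 := by
    intro a b hb h0
    apply hb
    simpa [C₁.coordVMinus_basis hAlt] using congrArg C₁.coordVMinus h0
  have hne' : ∀ c d : ℝ, c ≠ 0 ∨ d ≠ 0 → c • C₁.uMinus + d • C₁.vPlus ≠ 0 := by
    intro c d hcd h0
    have hc : c = 0 := by simpa [C₁.coordUMinus_basis hAlt] using congrArg C₁.coordUMinus h0
    have hd : d = 0 := by simpa [C₁.coordVPlus_basis hAlt] using congrArg C₁.coordVPlus h0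
    tauto
  have habcd := hG₁
  rw [C₁.stemDet_of_mem hdim hAlt hw hw', hquad, hquad'] at habcd
  have hb : b ≠ 0 := by rintro rfl; simp at habcd
  have ha : a ≠ 0 := by rintro rfl; simp at habcd
  have hd : d ≠ 0 := by rintro rfl; simp at habcd
  set α := C₂.torusForm C₁.uPlus C₁.uMinus with hα
  set β := C₂.torusForm C₁.uPlus C₁.vPlus with hβ
  set γ := C₂.torusForm C₁.vMinus C₁.uMinus with hγ
  set δ := C₂.torusForm C₁.vMinus C₁.vPlus with hδ
  have hB : ∀ a b c d : ℝ, C₂.torusForm (a • C₁.uPlus + b • C₁.vMinus)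
      (c • C₁.uMinus + d • C₁.vPlus) = c * (a * α + b * γ) + d * (a * β + b * δ) := by
    intro a b c d
    simp only [torusForm_add_left, torusForm_add_right, torusForm_smul_left, torusForm_smul_right,
      hα, hβ, hγ, hδ]
  rw [hB] at hT
  by_cases h₁ : a * α + b * γ = 0 ∧ a * β + b * δ = 0
  -- Here `B(w, ·) = 0`: `w` stays fixed and `w'` moves to a multiple of `v₊`.
  · refine exists_mem_closedStems_of_path C₁ C₂ hdim hAlt
      (x := fun _ => a • C₁.uPlus + b • C₁.vMinus)
      (y := fun t => (t * c) • C₁.uMinus + d • C₁.vPlus) (by fun_prop) (by fun_prop)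
      (fun t => hw) (fun t => hmem' _ _) (fun t => hw0) (fun t => hne' _ _ (Or.inr hd))
      (fun t => ?_) ?_ (by simpa using hG₁) (by simpa using hG₂)
    · rw [hB, h₁.1, h₁.2]; ring
    · rw [C₁.stemDet_of_mem hdim hAlt hw (hmem' _ _), hquad']; ring
  by_cases h₂ : c * α + d * β = 0
  -- Since `B(w, w') = 0` and `b ≠ 0`, the vanishing of `B(u₊, w')` forces that of `B(v₋, w')`, so
  -- `w'` is in the right kernel.
  · have h₃ : c * γ + d * δ = 0 := by
      have : b * (c * γ + d * δ) = 0 := by linear_combination hT - a * h₂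
      exact (mul_eq_zero.1 this).resolve_left hb
    refine exists_mem_closedStems_of_path C₁ C₂ hdim hAlt
      (x := fun t => (t * a) • C₁.uPlus + b • C₁.vMinus)
      (y := fun _ => c • C₁.uMinus + d • C₁.vPlus) (by fun_prop) (by fun_prop)
      (fun t => hmem _ _) (fun t => hw') (fun t => hne _ _ hb) (fun t => hw'0)
      (fun t => ?_) ?_ (by simpa using hG₁) (by simpa using hG₂)
    · rw [hB]; linear_combination (t * a) * h₂ + b * h₃
    · rw [C₁.stemDet_of_mem hdim hAlt (hmem _ _) hw', hquad]; ring
  -- The annihilator vector never vanishes. If the moving vector were in the left kernel at some `t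
  -- ≠ 1`, then it and `w`, which differ by a nonzero multiple of `u₊`, would both annihilate `w'`,
  -- giving `B(u₊, w') = 0` against `h₂`; `t = 1` is excluded by `h₁`.
  · have hnd : ∀ t : ℝ, t * a * β + b * δ ≠ 0 ∨ -(t * a * α + b * γ) ≠ 0 := by
      intro t
      by_contra! h
      obtain ⟨hβδ, hαγ⟩ := h
      have key : a * (1 - t) * (c * α + d * β) = 0 := by
        linear_combination hT - d * hβδ + c * hαγ
      have ht : t = 1 := by
        have := (mul_eq_zero.1 key).resolve_right h₂
        have := (mul_eq_zero.1 this).resolve_left ha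
        linarith
      subst ht
      exact h₁ ⟨by linear_combination -hαγ, by linear_combination hβδ⟩
    -- at time `1` the second vector of the path is a multiple of the one we start from
    obtain ⟨k, hk, hk₁, hk₂⟩ : ∃ k : ℝ, k ≠ 0 ∧ a * β + b * δ = k * c ∧
        -(a * α + b * γ) = k * d := by
      have hk₂ : -(a * α + b * γ) = -(a * α + b * γ) / d * d := by field_simp
      have hk₁ : a * β + b * δ = -(a * α + b * γ) / d * c := by
        field_simp
        linear_combination hT
      refine ⟨_, ?_, hk₁, hk₂⟩
      intro hk
      rw [hk, zero_mul] at hk₁ hk₂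
      exact h₁ ⟨by linarith, hk₁⟩
    have hend : (a * β + b * δ) • C₁.uMinus + (-(a * α + b * γ)) • C₁.vPlus =
        k • (c • C₁.uMinus + d • C₁.vPlus) := by
      rw [hk₁, hk₂]
      module
    refine exists_mem_closedStems_of_path C₁ C₂ hdim hAlt
      (x := fun t => (t * a) • C₁.uPlus + b • C₁.vMinus)
      (y := fun t => (t * a * β + b * δ) • C₁.uMinus + (-(t * a * α + b * γ)) • C₁.vPlus)
      (by fun_prop) (by fun_prop)
      (fun t => hmem _ _) (fun t => hmem' _ _) (fun t => hne _ _ hb) (fun t => hne' _ _ (hnd t))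
      (fun t => ?_) ?_ ?_ ?_
    · rw [hB]; ring
    · rw [C₁.stemDet_of_mem hdim hAlt (hmem _ _) (hmem' _ _), hquad]; ring
    · simp only [one_mul, hend, stemDet_smul_right]
      positivity
    · simp only [one_mul, hend, stemDet_smul_right]
      positivity

end Pair

end LightlikeQuadrilateral

end EinsteinUniverse

/-! ### The three statements -/

theorem mainTheorem6 {V : Type*} [NormedAddCommGroup V] [NormedSpace ℝ V]
    (hdim : Module.finrank ℝ V = 4)
    (ω : LinearMap.BilinForm ℝ V) (hAlt : ω.IsAlt) (hNondeg : ω.Nondegenerate)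
    (C₁ C₂ : EinsteinUniverse.LightlikeQuadrilateral ω) :
    -- if the closed stems meet, then the closed stem of one surface meets a wing of the other
    ((C₁.closedStem ∩ C₂.closedStem).Nonempty →
      (C₁.closedStem ∩ C₂.wings).Nonempty ∨ (C₂.closedStem ∩ C₁.wings).Nonempty) ∧
    -- if the open stems meet, the same holds for the open stems, unless their boundaries meet
    ((C₁.stem ∩ C₂.stem).Nonempty → Disjoint C₁.stemBoundary C₂.stemBoundary →
      (C₁.stem ∩ C₂.wings).Nonempty ∨ (C₂.stem ∩ C₁.wings).Nonempty) ∧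
    -- two intersecting crooked surfaces do not intersect only in their stems
    ((C₁.crookedSurface ∩ C₂.crookedSurface).Nonempty →
      ¬ C₁.crookedSurface ∩ C₂.crookedSurface ⊆ C₁.stem ∩ C₂.stem) := by
  have hstems := EinsteinUniverse.LightlikeQuadrilateral.exists_mem_closedStems_of_stems_meet
    C₁ C₂ hdim hAlt
  have hw₁ := C₁.stemBoundary_subset_wings hdim hAlt
  have hw₂ := C₂.stemBoundary_subset_wings hdim hAlt
  refine ⟨?_, ?_, ?_⟩
  · rintro ⟨p, hp₁, hp₂⟩
    obtain ⟨q, hq₁, hq₂, hq⟩ : ∃ q, q ∈ C₁.closedStem ∧ q ∈ C₂.closedStem ∧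
        (q ∉ C₁.stem ∨ q ∉ C₂.stem) := by
      by_cases h : p ∈ C₁.stem ∧ p ∈ C₂.stem
      · exact hstems ⟨p, h⟩
      · exact ⟨p, hp₁, hp₂, not_and_or.1 h⟩
    rcases hq with hq | hq
    · exact Or.inr ⟨q, hq₂, hw₁ ⟨hq₁, hq⟩⟩
    · exact Or.inl ⟨q, hq₁, hw₂ ⟨hq₂, hq⟩⟩
  · intro h hdisj
    obtain ⟨q, hq₁, hq₂, hq⟩ := hstems h
    rcases hq with hq | hq
    · refine Or.inr ⟨q, ?_, hw₁ ⟨hq₁, hq⟩⟩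
      -- Were `q` also outside the other open stem, it would lie on both boundaries.
      by_contra hq'
      exact Set.disjoint_left.1 hdisj ⟨hq₁, hq⟩ ⟨hq₂, hq'⟩
    · refine Or.inl ⟨q, ?_, hw₂ ⟨hq₂, hq⟩⟩
      by_contra hq'
      exact Set.disjoint_left.1 hdisj ⟨hq₁, hq'⟩ ⟨hq₂, hq⟩
  · rintro ⟨p, hp⟩ hsub
    obtain ⟨q, hq₁, hq₂, hq⟩ := hstems ⟨p, hsub hp⟩
    -- `q` lies on both surfaces, because a closed stem is contained in its crooked surface, yet it
    -- misses one of the open stems.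
    have h := hsub ⟨(C₁.closedStem_subset hdim hAlt hq₁).symm,
      (C₂.closedStem_subset hdim hAlt hq₂).symm⟩
    exact hq.elim (fun h' => h' h.1) (fun h' => h' h.2)
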